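/- **Theorem (one-way LOCC de Finetti theorem).** There is a universal constant $C>0$ such that the following holds for all dimensions $d_A,d_B$ and all integers $k\ge 1$. Let $\rho_{AB}$ be a $k$-extendible state on $\mathbb C^{d_A}\otimes\mathbb C^{d_B}$, that is, a density matrix for which there is a state $\pi_{AB_1\cdots B_k}$ on $\mathbb C^{d_A}\otimes(\mathbb C^{d_B})^{\otimes k}$ with $\pi_{AB_j}=\rho_{AB}$ for every $j=1,\dots,k$ (this holds in particular if $\rho_{AB}$ is the reduced state on $AB_1$ of a state on $\mathbb C^{d_A}\otimes \mathrm{Sym}^k(\mathbb C^{d_B})$). A one-way LOCC measurement operator is an operator of the form $M=\sum_{x=1}^m A_x\otimes B_x$, with $m$ arbitrary, $0\le A_x\le I$ and $B_x\ge 0$ for all $x$, and $\sum_x B_x=I$. A separable state is a convex combination of states $|\psi\rangle\langle\psi|\otimes|\varphi\rangle\langle\varphi|$ with unit vectors $\psi,\varphi$. Then: 1. For every one-way LOCC measurement operator $M$ there is a separable state $\sigma$ (which may depend on $M$) with $$|\operatorname{tr} M(\rho-\sigma)|\le C\sqrt{\frac{\log_2 d_A}{k}}.$$ 2. There is a single separable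 state $\sigma$ such that this bound holds for all one-way LOCC measurement operators $M$ simultaneously, and moreover $$\|\rho-\sigma\|_{\text{1-LOCC}}\le\sqrt{\frac{2\ln(2)\,\log_2 d_A}{k}},$$ where $\tfrac12\|X\|_{\text{1-LOCC}}:=\sup_M|\operatorname{tr}(MX)|$, the supremum being over all one-way LOCC measurement operators $M$. -/

import Mathlib

open scoped Kronecker ComplexOrder

namespace QInfo

/-- A density matrix (quantum state): positive semidefinite with trace one. -/
def IsState {n : Type*} [Fintype n] (ρ : Matrix n n ℂ) : Prop :=
  ρ.PosSemidef ∧ ρ.trace = 1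

/-- A product pure state `|ψ⟩⟨ψ| ⊗ |φ⟩⟨φ|` on `ℂ^dA ⊗ ℂ^dB`, with `ψ`, `φ` unit vectors. -/
def IsPureProduct {dA dB : ℕ} (σ : Matrix (Fin dA × Fin dB) (Fin dA × Fin dB) ℂ) : Prop :=
  ∃ (ψ : Fin dA → ℂ) (φ : Fin dB → ℂ), star ψ ⬝ᵥ ψ = 1 ∧ star φ ⬝ᵥ φ = 1 ∧
    σ = Matrix.vecMulVec ψ (star ψ) ⊗ₖ Matrix.vecMulVec φ (star φ)

/-- A separable state: a (finite) convex combination of product pure states. -/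
def IsSeparable {dA dB : ℕ} (σ : Matrix (Fin dA × Fin dB) (Fin dA × Fin dB) ℂ) : Prop :=
  σ ∈ convexHull ℝ {τ : Matrix (Fin dA × Fin dB) (Fin dA × Fin dB) ℂ | IsPureProduct τ}

/-- The reduced operator `π_{A B_j}` of an operator `π` on `A ⊗ B_0 ⊗ ⋯ ⊗ B_{k-1}`: the partial
trace over all `B_i` with `i ≠ j`. The basis of `B_0 ⊗ ⋯ ⊗ B_{k-1}` is indexed by functions
`Fin k → Fin dB`; the sum runs over the strings `c` with `c j = b`, and the column index agrees
with `c` away from `j`. -/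
noncomputable def marginal {dA dB k : ℕ}
    (π : Matrix (Fin dA × (Fin k → Fin dB)) (Fin dA × (Fin k → Fin dB)) ℂ) (j : Fin k) :
    Matrix (Fin dA × Fin dB) (Fin dA × Fin dB) ℂ :=
  Matrix.of fun x y =>
    ∑ c : Fin k → Fin dB, if c j = x.2 then π (x.1, c) (y.1, Function.update c j y.2) else 0

/-- `ρ_{AB}` is `k`-extendible: there is a state `π` on `A ⊗ B_0 ⊗ ⋯ ⊗ B_{k-1}` all of whose
marginals `π_{A B_j}` are equal to `ρ`. -/
def IsExtendible {dA dB : ℕ} (k : ℕ)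
    (ρ : Matrix (Fin dA × Fin dB) (Fin dA × Fin dB) ℂ) : Prop :=
  ∃ π : Matrix (Fin dA × (Fin k → Fin dB)) (Fin dA × (Fin k → Fin dB)) ℂ,
    IsState π ∧ ∀ j : Fin k, marginal π j = ρ

/-- `ρ_{AB}` is symmetrically `k`-extendible: it is the marginal on `A` and the first `B` of a
state supported on `ℂ^dA ⊗ Sym^k(ℂ^dB)`, that is, of a state fixed under left multiplication by
the permutation operators of the `k` systems `B`. -/
def IsSymExtendible {dA dB : ℕ} (k : ℕ)
    (ρ : Matrix (Fin dA × Fin dB) (Fin dA × Fin dB) ℂ) : Prop :=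
  ∃ π : Matrix (Fin dA × (Fin k → Fin dB)) (Fin dA × (Fin k → Fin dB)) ℂ,
    IsState π ∧
    (∀ (s : Equiv.Perm (Fin k)) (a : Fin dA) (c : Fin k → Fin dB)
      (y : Fin dA × (Fin k → Fin dB)), π (a, c ∘ s) y = π (a, c) y) ∧
    ∃ h : 0 < k, marginal π ⟨0, h⟩ = ρ

/-- Symmetric extendibility is the stronger notion, so a theorem about `IsExtendible` states
covers the symmetrically extendible ones. -/
theorem IsSymExtendible.isExtendible {dA dB k : ℕ}
    {ρ : Matrix (Fin dA × Fin dB) (Fin dA × Fin dB) ℂ} (hρ : IsSymExtendible k ρ) :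
    IsExtendible k ρ := by
  obtain ⟨π, hπ, hs, h, rfl⟩ := hρ
  refine ⟨π, hπ, fun j => ?_⟩
  have hcol : ∀ (s : Equiv.Perm (Fin k)) (x : Fin dA × (Fin k → Fin dB)) (a : Fin dA)
      (c : Fin k → Fin dB), π x (a, c ∘ s) = π x (a, c) := by
    intro s x a c
    rw [← hπ.1.1.apply x (a, c ∘ s), ← hπ.1.1.apply x (a, c), hs]
  ext x y
  simp only [marginal, Matrix.of_apply]
  refine Fintype.sum_equiv ((Equiv.swap (⟨0, h⟩ : Fin k) j).arrowCongr (Equiv.refl _)) _ _ ?_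
  intro c
  have e : ((Equiv.swap (⟨0, h⟩ : Fin k) j).arrowCongr (Equiv.refl (Fin dB))) c
      = c ∘ Equiv.swap (⟨0, h⟩ : Fin k) j := by
    ext i; simp [Equiv.arrowCongr]
  have u : Function.update (c ∘ Equiv.swap (⟨0, h⟩ : Fin k) j) ⟨0, h⟩ y.2
      = Function.update c j y.2 ∘ Equiv.swap (⟨0, h⟩ : Fin k) j := by
    have := Function.update_comp_equiv c (Equiv.swap (⟨0, h⟩ : Fin k) j) j y.2
    simpa using this.symm
  rw [e, u, hs, hcol]
  simp

/-- One-way LOCC measurement operators: Bob measures a POVM `(B x)`, sends the outcome `x` to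
Alice, and she accepts according to the two-outcome measurement `{A x, 1 - A x}`. -/
def IsOneLOCC {dA dB : ℕ} (M : Matrix (Fin dA × Fin dB) (Fin dA × Fin dB) ℂ) : Prop :=
  ∃ (m : ℕ) (A : Fin m → Matrix (Fin dA) (Fin dA) ℂ) (B : Fin m → Matrix (Fin dB) (Fin dB) ℂ),
    (∀ x, (A x).PosSemidef ∧ (1 - A x).PosSemidef) ∧
    (∀ x, (B x).PosSemidef) ∧ ∑ x, B x = 1 ∧
    M = ∑ x, A x ⊗ₖ B x

/-- The one-way LOCC norm, normalized by `(1/2) ‖X‖ = sup_M |tr (M X)|`, where `M` ranges over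
the one-way LOCC measurement operators. -/
noncomputable def oneLOCCNorm {dA dB : ℕ}
    (X : Matrix (Fin dA × Fin dB) (Fin dA × Fin dB) ℂ) : ℝ :=
  2 * sSup {r : ℝ | ∃ M : Matrix (Fin dA × Fin dB) (Fin dA × Fin dB) ℂ,
    IsOneLOCC M ∧ r = ‖(M * X).trace‖}

end QInfo

/-! ### Scalar relative-entropy bounds and a quantum Pinsker inequality -/

namespace QInfo

open Matrix

/-! Fix `M = ∑ x, A x ⊗ E x` and let Bob apply the measurement `E` to his `k` systems one after the
other. Before each measurement, conditionally on the earlier outcomes, compare the current state of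
`A` and the next `B` with the product of its marginals. The change in acceptance probability is
controlled by the average relative entropy between Alice's states after and before the outcome is
known (Pinsker), and this average is exactly the drop of Alice's entropy. The drops telescope; since
the entropy starts at most at `log dA` and stays nonnegative, they add up to at most `log dA`.

Averaging the conditional product states over outcomes gives, for every `j`, a separable `σ j` to be
compared with the marginal on `A B_j`. As all these marginals equal `ρ`, the mean of the `σ j` has
one-sided error at most `√(log dA / (2k))` on `M`. This is `exists_sepCone_sum_le` and
`exists_isSeparable_trace_le`; Pinsker enters through `pinsker_dual` and `sum_le_homEntropy_sub`.

This `σ` depends on `M`. Separable states form a compact convex set, one-way LOCC operators a convex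
set, and the error is affine in each variable, so Sion's minimax theorem yields one `σ` for all `M`.
Replacing `M` by `1 - M` flips the sign of the error, which gives the absolute value. -/

theorem log_ge_rational {x : ℝ} (hx : 0 < x) :
    5 / 2 - 1 / (4 * x) - 27 / (4 * (x + 2)) ≤ Real.log x := by
  set F : ℝ → ℝ := fun x => Real.log x - (5 / 2 - 1 / (4 * x) - 27 / (4 * (x + 2))) with hF
  -- The constants make both sides agree to third order at `1`; the derivative of the difference is
  -- then a cube of `y - 1` over a square, so `1` is the global minimum.
  have hd : ∀ y : ℝ, 0 < y → HasDerivAt F ((y - 1) ^ 3 / (y ^ 2 * (y + 2) ^ 2)) y := by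
    intro y hy
    have h1 := Real.hasDerivAt_log hy.ne'
    have h2 : HasDerivAt (fun y : ℝ => 1 / (4 * y)) _ y :=
      (hasDerivAt_const y (1 : ℝ)).div ((hasDerivAt_id y).const_mul 4) (by simpa using hy.ne')
    have h3 : HasDerivAt (fun y : ℝ => 27 / (4 * (y + 2))) _ y :=
      (hasDerivAt_const y (27 : ℝ)).div (((hasDerivAt_id y).add_const 2).const_mul 4)
        (by simp; positivity)
    refine (h1.sub (((hasDerivAt_const y (5 / 2 : ℝ)).sub h2).sub h3)).congr_deriv ?_
    field_simp
    ring
  have h1 : F 1 = 0 := by norm_num [hF]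
  suffices 0 ≤ F x by simpa [hF] using this
  rw [← h1]
  rcases le_total 1 x with h | h
  · refine monotoneOn_of_deriv_nonneg (convex_Ici 1)
      (fun y hy => (hd y (zero_lt_one.trans_le hy)).continuousAt.continuousWithinAt)
      (fun y hy => ?_) (fun y hy => ?_) (Set.mem_Ici.2 le_rfl) h h
    all_goals rw [interior_Ici, Set.mem_Ioi] at hy
    · exact (hd y (by linarith)).differentiableAt.differentiableWithinAt
    · rw [(hd y (by linarith)).deriv]
      have : 0 ≤ y - 1 := by linarith
      positivity
  · refine antitoneOn_of_deriv_nonpos (convex_Icc x 1)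
      (fun y hy => (hd y (hx.trans_le hy.1)).continuousAt.continuousWithinAt)
      (fun y hy => ?_) (fun y hy => ?_) (Set.left_mem_Icc.2 h) (Set.right_mem_Icc.2 h) h
    all_goals rw [interior_Icc] at hy
    · exact (hd y (hx.trans hy.1)).differentiableAt.differentiableWithinAt
    · rw [(hd y (hx.trans hy.1)).deriv]
      refine div_nonpos_of_nonpos_of_nonneg ?_ (by positivity)
      exact Odd.pow_nonpos (by decide) (by linarith [hy.2])

/-- A sharp quadratic lower bound for the Bregman divergence of `x ↦ x log x`. -/
theorem three_mul_sub_sq_le {p q : ℝ} (hp : 0 ≤ p) (hq : 0 ≤ q) (h : q = 0 → p = 0) :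
    3 * (p - q) ^ 2 ≤ (2 * p + 4 * q) * (p * Real.log p - p * Real.log q - p + q) := by
  rcases hp.eq_or_lt with rfl | hp
  · nlinarith
  have hq : 0 < q := hq.lt_of_ne fun h0 => hp.ne' (h h0.symm)
  have key := log_ge_rational (div_pos hp hq)
  rw [Real.log_div hp.ne' hq.ne'] at key
  have e : 5 / 2 - 1 / (4 * (p / q)) - 27 / (4 * (p / q + 2))
      = (3 * (p - q) ^ 2 / (2 * p + 4 * q) + p - q) / p := by
    field_simp
    ring
  rw [e, div_le_iff₀ hp] at key
  have : 3 * (p - q) ^ 2 / (2 * p + 4 * q) ≤ p * Real.log p - p * Real.log q - p + q := by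
    linarith
  rw [div_le_iff₀ (by positivity)] at this
  linarith

/-- AM-GM applied to the scalar bound, for one pair of eigenvectors with overlap `w`. A pair with `w
= 0` contributes nothing on the left, so the support condition matters only for `w ≠ 0`. -/
theorem le_add_of_relEntropy_term {p q t : ℝ} (hp : 0 ≤ p) (hq : 0 ≤ q) {w a : ℂ}
    (h : q = 0 → p = 0 ∨ w = 0) :
    t * ((p - q) * (star w * a).re) ≤
      ‖w‖ ^ 2 * (p * Real.log p - p * Real.log q - p + q)
        + t ^ 2 / 12 * (‖a‖ ^ 2 * (2 * p + 4 * q)) := by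
  rcases eq_or_ne w 0 with rfl | hw
  · simp; positivity
  have hs := three_mul_sub_sq_le hp hq fun h0 => (h h0).resolve_right hw
  set D := p * Real.log p - p * Real.log q - p + q
  have hr : |(star w * a).re| ≤ ‖w‖ * ‖a‖ := by
    simpa using Complex.abs_re_le_norm (star w * a)
  set r := (star w * a).re
  have hr2 : r ^ 2 ≤ ‖w‖ ^ 2 * ‖a‖ ^ 2 := by
    rw [← mul_pow]; exact sq_le_sq' (neg_le_of_abs_le hr) (le_of_abs_le hr)
  have hg : 0 ≤ 2 * p + 4 * q := by positivity
  rcases hg.eq_or_lt with h0 | hg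
  · have hp0 : p = 0 := by linarith
    have hq0 : q = 0 := by linarith
    simp [D, hp0, hq0]
  have hD : 0 ≤ D := by
    by_contra hD
    have := mul_neg_of_pos_of_neg hg (not_le.1 hD)
    nlinarith [sq_nonneg (p - q)]
  have hsq : (t * ((p - q) * r)) ^ 2 ≤
      4 * (‖w‖ ^ 2 * D) * (t ^ 2 / 12 * (‖a‖ ^ 2 * (2 * p + 4 * q))) := by
    calc (t * ((p - q) * r)) ^ 2 = t ^ 2 * (p - q) ^ 2 * r ^ 2 := by ring
      _ ≤ t ^ 2 * (p - q) ^ 2 * (‖w‖ ^ 2 * ‖a‖ ^ 2) := by gcongr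
      _ = t ^ 2 * ‖w‖ ^ 2 * ‖a‖ ^ 2 / 3 * (3 * (p - q) ^ 2) := by ring
      _ ≤ t ^ 2 * ‖w‖ ^ 2 * ‖a‖ ^ 2 / 3 * ((2 * p + 4 * q) * D) := by gcongr
      _ = _ := by ring
  have hX : 0 ≤ ‖w‖ ^ 2 * D := by positivity
  have hY : 0 ≤ t ^ 2 / 12 * (‖a‖ ^ 2 * (2 * p + 4 * q)) := by positivity
  refine le_of_abs_le (abs_le_of_sq_le_sq (hsq.trans ?_) (by positivity))
  nlinarith [sq_nonneg (‖w‖ ^ 2 * D - t ^ 2 / 12 * (‖a‖ ^ 2 * (2 * p + 4 * q)))]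

variable {n : Type*} [Fintype n]

theorem mul_conjTranspose_diag_re {m : Type*} (K : Matrix m n ℂ) (i : m) :
    ((K * Kᴴ) i i).re = ∑ j, ‖K i j‖ ^ 2 := by
  simp only [mul_apply, conjTranspose_apply, Complex.re_sum]
  refine Finset.sum_congr rfl fun j _ => ?_
  rw [Complex.star_def, Complex.mul_conj, Complex.normSq_eq_norm_sq, Complex.ofReal_re]

theorem conjTranspose_mul_diag_re {m : Type*} (K : Matrix n m ℂ) (j : m) :
    ((Kᴴ * K) j j).re = ∑ i, ‖K i j‖ ^ 2 := by
  simpa using mul_conjTranspose_diag_re Kᴴ j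

variable [DecidableEq n]

theorem trace_mul_diagonal_conj (A U : Matrix n n ℂ) (p : n → ℂ) :
    (A * (U * diagonal p * Uᴴ)).trace = ∑ i, p i * (Uᴴ * A * U) i i := by
  rw [← Matrix.mul_assoc, ← Matrix.mul_assoc, trace_mul_comm, ← Matrix.mul_assoc,
    ← Matrix.mul_assoc, trace]
  simp [mul_diagonal, mul_comm]

/-- The quantum Pinsker inequality in dual form: for `τ = U diag(p) Uᴴ` and `ρ = V diag(q) Vᴴ`
the relative entropy of `τ` to `ρ` dominates `t tr A (τ - ρ) - t² tr τ / 8` whenever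
`-1/2 ≤ A ≤ 1/2`. -/
theorem pinsker_dual {U V : Matrix n n ℂ} (hU : U * Uᴴ = 1) (hV : V * Vᴴ = 1) {p q : n → ℝ}
    (hp : ∀ i, 0 ≤ p i) (hq : ∀ i, 0 ≤ q i) (hpq : ∑ i, p i = ∑ i, q i)
    (hsupp : ∀ i j, q j = 0 → p i = 0 ∨ (Uᴴ * V) i j = 0) {A : Matrix n n ℂ} (hA : A.IsHermitian)
    (hA2 : ((1 / 4 : ℂ) • (1 : Matrix n n ℂ) - A * A).PosSemidef) (t : ℝ) :
    t * (A * (U * diagonal (fun i => (p i : ℂ)) * Uᴴ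
        - V * diagonal (fun i => (q i : ℂ)) * Vᴴ)).trace.re - (∑ i, p i) * t ^ 2 / 8 ≤
      ∑ i, p i * Real.log (p i)
        - ∑ j, (∑ i, ‖(Uᴴ * V) i j‖ ^ 2 * p i) * Real.log (q j) := by
  have hU' : Uᴴ * U = 1 := mul_eq_one_comm.1 hU
  have hV' : Vᴴ * V = 1 := mul_eq_one_comm.1 hV
  set W := Uᴴ * V with hW
  set K := Uᴴ * A * V with hK
  have hWW : W * Wᴴ = 1 := by
    rw [hW, conjTranspose_mul, conjTranspose_conjTranspose, Matrix.mul_assoc,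
      ← Matrix.mul_assoc V, hV, Matrix.one_mul, hU']
  have hWW' : Wᴴ * W = 1 := mul_eq_one_comm.1 hWW
  have hKh : Kᴴ = Vᴴ * A * U := by
    rw [hK, conjTranspose_mul, conjTranspose_mul, conjTranspose_conjTranspose, hA.eq,
      Matrix.mul_assoc]
  have hKK : K * Kᴴ = Uᴴ * (A * A) * U := by
    rw [hKh, hK]
    calc Uᴴ * A * V * (Vᴴ * A * U) = Uᴴ * A * (V * Vᴴ) * A * U := by
          simp only [Matrix.mul_assoc]
      _ = _ := by rw [hV, Matrix.mul_one]; simp only [Matrix.mul_assoc]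
  have hKK' : Kᴴ * K = Vᴴ * (A * A) * V := by
    rw [hKh, hK]
    calc Vᴴ * A * U * (Uᴴ * A * V) = Vᴴ * A * (U * Uᴴ) * A * V := by
          simp only [Matrix.mul_assoc]
      _ = _ := by rw [hU, Matrix.mul_one]; simp only [Matrix.mul_assoc]
  have hKW : Uᴴ * A * U = K * Wᴴ := by
    rw [hK, hW, conjTranspose_mul, conjTranspose_conjTranspose, Matrix.mul_assoc (Uᴴ * A),
      ← Matrix.mul_assoc V, hV, Matrix.one_mul]
  have hKW' : Vᴴ * A * V = Wᴴ * K := by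
    rw [hK, hW, conjTranspose_mul, conjTranspose_conjTranspose, Matrix.mul_assoc Uᴴ,
      Matrix.mul_assoc Vᴴ U, ← Matrix.mul_assoc U, hU, Matrix.one_mul, Matrix.mul_assoc]
  -- `A² ≤ 1/4` survives unitary conjugation, so every row and column of `K` has squared norm at
  -- most `1/4`.
  have hbound : ∀ X : Matrix n n ℂ, Xᴴ * X = 1 → ∀ i, ((Xᴴ * (A * A) * X) i i).re ≤ 1 / 4 := by
    intro X hX i
    have h := (hA2.conjTranspose_mul_mul_same X).diag_nonneg (i := i)
    rw [Matrix.mul_sub, Matrix.sub_mul, Matrix.mul_smul, Matrix.mul_one, Matrix.smul_mul, hX,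
      Matrix.sub_apply, Matrix.smul_apply, one_apply_eq, sub_nonneg] at h
    have := (Complex.le_def.1 h).1
    norm_num at this
    linarith
  have hrow : ∀ i, ∑ j, ‖W i j‖ ^ 2 = 1 := fun i => by
    rw [← mul_conjTranspose_diag_re, hWW]; simp
  have hcol : ∀ j, ∑ i, ‖W i j‖ ^ 2 = 1 := fun j => by
    rw [← conjTranspose_mul_diag_re, hWW']; simp
  have hKrow : ∀ i, ∑ j, ‖K i j‖ ^ 2 ≤ 1 / 4 := fun i => by
    rw [← mul_conjTranspose_diag_re, hKK]; exact hbound U hU' i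
  have hKcol : ∀ j, ∑ i, ‖K i j‖ ^ 2 ≤ 1 / 4 := fun j => by
    rw [← conjTranspose_mul_diag_re, hKK']; exact hbound V hV' j
  -- Inserting `W` writes both traces as sums over pairs of eigenvectors of the two operators. The
  -- noncommuting problem thereby reduces to the scalar inequality, pair by pair.
  have htr : (A * (U * diagonal (fun i => (p i : ℂ)) * Uᴴ
        - V * diagonal (fun i => (q i : ℂ)) * Vᴴ)).trace.re
      = ∑ i, ∑ j, (p i - q j) * (star (W i j) * K i j).re := by
    rw [Matrix.mul_sub, trace_sub, trace_mul_diagonal_conj, trace_mul_diagonal_conj, hKW, hKW',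
      Complex.sub_re, Complex.re_sum, Complex.re_sum]
    simp only [Complex.re_ofReal_mul, mul_apply, Complex.re_sum, conjTranspose_apply,
      Finset.mul_sum, sub_mul, Finset.sum_sub_distrib]
    rw [Finset.sum_comm (f := fun i j => q i * _)]
    simp only [mul_comm (K _ _)]
  have hmain : t * (∑ i, ∑ j, (p i - q j) * (star (W i j) * K i j).re) ≤
      ∑ i, ∑ j, ‖W i j‖ ^ 2 * (p i * Real.log (p i) - p i * Real.log (q j) - p i + q j)
        + t ^ 2 / 12 * ∑ i, ∑ j, ‖K i j‖ ^ 2 * (2 * p i + 4 * q j) := by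
    simp only [Finset.mul_sum, ← Finset.sum_add_distrib]
    exact Finset.sum_le_sum fun i _ => Finset.sum_le_sum fun j _ =>
      le_add_of_relEntropy_term (hp i) (hq j) (hsupp i j)
  have hent : ∑ i, ∑ j, ‖W i j‖ ^ 2 * (p i * Real.log (p i) - p i * Real.log (q j) - p i + q j)
      = ∑ i, p i * Real.log (p i) - ∑ j, (∑ i, ‖W i j‖ ^ 2 * p i) * Real.log (q j) := by
    have e1 : ∑ i, ∑ j, ‖W i j‖ ^ 2 * (p i * Real.log (p i) - p i)
        = ∑ i, p i * Real.log (p i) - ∑ i, p i := by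
      simp only [← Finset.sum_mul, hrow, one_mul, Finset.sum_sub_distrib]
    have e2 : ∑ i, ∑ j, ‖W i j‖ ^ 2 * q j = ∑ i, p i := by
      rw [Finset.sum_comm, hpq]
      simp only [← Finset.sum_mul, hcol, one_mul]
    have e3 : ∑ i, ∑ j, ‖W i j‖ ^ 2 * (p i * Real.log (q j))
        = ∑ j, (∑ i, ‖W i j‖ ^ 2 * p i) * Real.log (q j) := by
      rw [Finset.sum_comm]
      simp only [Finset.sum_mul, mul_assoc]
    have : ∀ i j, ‖W i j‖ ^ 2 * (p i * Real.log (p i) - p i * Real.log (q j) - p i + q j)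
        = ‖W i j‖ ^ 2 * (p i * Real.log (p i) - p i) + ‖W i j‖ ^ 2 * q j
          - ‖W i j‖ ^ 2 * (p i * Real.log (q j)) := fun i j => by ring
    simp only [this, Finset.sum_sub_distrib, Finset.sum_add_distrib]
    rw [← e3]
    simp only [← Finset.sum_sub_distrib] at e1 ⊢
    rw [e1, e2]; simp
  -- The factor is `(2 + 4) / 4`; multiplied by `t² / 12` it gives the `t² / 8` of the statement.
  have hquad : ∑ i, ∑ j, ‖K i j‖ ^ 2 * (2 * p i + 4 * q j) ≤ 3 / 2 * ∑ i, p i := by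
    have e1 : ∑ i, ∑ j, ‖K i j‖ ^ 2 * (2 * p i) ≤ 1 / 2 * ∑ i, p i := by
      rw [Finset.mul_sum]
      refine Finset.sum_le_sum fun i _ => ?_
      rw [← Finset.sum_mul]
      nlinarith [hKrow i, hp i]
    have e2 : ∑ i, ∑ j, ‖K i j‖ ^ 2 * (4 * q j) ≤ ∑ i, p i := by
      rw [hpq, Finset.sum_comm]
      refine Finset.sum_le_sum fun i _ => ?_
      rw [← Finset.sum_mul]
      nlinarith [hKcol i, hq i]
    simp only [mul_add, Finset.sum_add_distrib]
    linarith
  rw [htr]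
  rw [hent] at hmain
  nlinarith [mul_le_mul_of_nonneg_left hquad (show 0 ≤ t ^ 2 / 12 by positivity)]

end QInfo

/-! ### Homogeneous entropy and its concavity -/

namespace QInfo

open Matrix

variable {n : Type*} [Fintype n]

theorem trace_re_nonneg {τ : Matrix n n ℂ} (h : τ.PosSemidef) : 0 ≤ τ.trace.re :=
  (Complex.le_def.1 h.trace_nonneg).1

variable [DecidableEq n]

theorem exists_unitary_diagonalization {τ : Matrix n n ℂ} (h : τ.IsHermitian) :
    ∃ U : Matrix n n ℂ, U * Uᴴ = 1 ∧ τ = U * diagonal (fun i => (h.eigenvalues i : ℂ)) * Uᴴ := by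
  refine ⟨h.eigenvectorUnitary, Unitary.coe_mul_star_self h.eigenvectorUnitary, ?_⟩
  conv_lhs => rw [h.spectral_theorem, Unitary.conjStarAlgAut_apply]
  rfl

theorem trace_re_eq_sum_eigenvalues {τ : Matrix n n ℂ} (h : τ.IsHermitian) :
    τ.trace.re = ∑ i, h.eigenvalues i := by
  rw [h.trace_eq_sum_eigenvalues, Complex.re_sum]; rfl

/-- The von Neumann entropy of a positive operator, made homogeneous of degree one: for a state
`ρ` and `c ≥ 0` its value at `c ρ` is `c` times the entropy of `ρ`. -/
noncomputable def homEntropy {τ : Matrix n n ℂ} (h : τ.IsHermitian) : ℝ :=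
  ∑ i, Real.negMulLog (h.eigenvalues i) + τ.trace.re * Real.log τ.trace.re

theorem homEntropy_nonneg {τ : Matrix n n ℂ} (h : τ.PosSemidef) : 0 ≤ homEntropy h.1 := by
  rw [homEntropy, trace_re_eq_sum_eigenvalues h.1, Finset.sum_mul, ← Finset.sum_add_distrib]
  refine Finset.sum_nonneg fun i _ => ?_
  have h0 := h.eigenvalues_nonneg
  have hle : h.1.eigenvalues i ≤ ∑ i, h.1.eigenvalues i :=
    Finset.single_le_sum (fun j _ => h0 j) (Finset.mem_univ i)
  rcases (h0 i).eq_or_lt with h1 | h1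
  · simp [← h1]
  · have := mul_le_mul_of_nonneg_left (Real.log_le_log h1 hle) h1.le
    rw [Real.negMulLog]
    linarith

theorem homEntropy_le_log_card {τ : Matrix n n ℂ} (h : τ.PosSemidef) (htr : τ.trace = 1) :
    homEntropy h.1 ≤ Real.log (Fintype.card n) := by
  have hsum : ∑ i, h.1.eigenvalues i = 1 := by
    rw [← trace_re_eq_sum_eigenvalues h.1, htr, Complex.one_re]
  have hne : Nonempty n := by
    by_contra hn
    rw [not_nonempty_iff] at hn
    simp at hsum
  have hd : (0 : ℝ) < Fintype.card n := by exact_mod_cast Fintype.card_pos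
  have key : ∀ i, Real.negMulLog (h.1.eigenvalues i) ≤
      h.1.eigenvalues i * Real.log (Fintype.card n)
        + (1 / Fintype.card n - h.1.eigenvalues i) := by
    intro i
    rcases (h.eigenvalues_nonneg i).eq_or_lt with h1 | h1
    · simp [← h1]
    · set x := h.1.eigenvalues i
      -- Comparison with the uniform distribution: summed over `i`, the correction `1 / d - x`
      -- vanishes.
      have h2 := Real.log_le_sub_one_of_pos (x := 1 / (Fintype.card n * x)) (by positivity)
      rw [Real.log_div one_ne_zero (by positivity), Real.log_mul hd.ne' h1.ne', Real.log_one] at h2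
      have h3 := mul_le_mul_of_nonneg_left h2 h1.le
      have h4 : x * (1 / (Fintype.card n * x) - 1) = 1 / Fintype.card n - x := by
        field_simp
      rw [Real.negMulLog]
      linarith
  rw [homEntropy, htr]
  have := Finset.sum_le_sum fun i (_ : i ∈ Finset.univ) => key i
  rw [Finset.sum_add_distrib, ← Finset.sum_mul, Finset.sum_sub_distrib, hsum] at this
  simp at this
  simpa using this

theorem conj_diagonal_diag_re (W : Matrix n n ℂ) (p : n → ℝ) (j : n) :
    ((Wᴴ * diagonal (fun i => (p i : ℂ)) * W) j j).re = ∑ i, ‖W i j‖ ^ 2 * p i := by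
  rw [mul_apply, Complex.re_sum]
  refine Finset.sum_congr rfl fun i _ => ?_
  rw [mul_diagonal, conjTranspose_apply, mul_right_comm, Complex.star_def, mul_comm (starRingEnd ℂ _),
    Complex.mul_conj, Complex.normSq_eq_norm_sq, ← Complex.ofReal_mul, Complex.ofReal_re]

/-- The difference is `A - A² = A (1 - A) A + (1 - A) A (1 - A)`. -/
theorem sub_half_sq_le {A : Matrix n n ℂ} (hA : A.PosSemidef) (hA1 : (1 - A).PosSemidef) :
    ((1 / 4 : ℂ) • (1 : Matrix n n ℂ)
      - (A - (1 / 2 : ℂ) • 1) * (A - (1 / 2 : ℂ) • 1)).PosSemidef := by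
  have h := (hA1.conjTranspose_mul_mul_same A).add (hA.conjTranspose_mul_mul_same (1 - A))
  rw [hA.1.eq, hA1.1.eq] at h
  convert h using 1
  simp only [Matrix.mul_sub, Matrix.sub_mul, Matrix.mul_one, Matrix.one_mul, Matrix.mul_smul,
    Matrix.smul_mul, smul_sub, smul_smul, Matrix.mul_assoc]
  module

/-- Concavity of the entropy with a Pinsker type remainder, for an ensemble `τ` of positive
operators with sum `ρ`. -/
theorem sum_le_homEntropy_sub {ι : Type*} [Fintype ι] {τ : ι → Matrix n n ℂ}
    (hτ : ∀ x, (τ x).PosSemidef) {ρ : Matrix n n ℂ} (hρ : ρ.PosSemidef) (hsum : ∑ x, τ x = ρ)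
    {A : ι → Matrix n n ℂ} (hA : ∀ x, (A x).PosSemidef ∧ (1 - A x).PosSemidef) (t : ℝ) :
    ∑ x, (t * ((A x * τ x).trace.re
        - (τ x).trace.re / ρ.trace.re * (A x * ρ).trace.re) - (τ x).trace.re * t ^ 2 / 8) ≤
      homEntropy hρ.1 - ∑ x, homEntropy (hτ x).1 := by
  obtain ⟨V, hV, hρs⟩ := exists_unitary_diagonalization hρ.1
  set q := hρ.1.eigenvalues with hq
  set P := ρ.trace.re with hP
  have hV' : Vᴴ * V = 1 := mul_eq_one_comm.1 hV
  have hq0 : ∀ j, 0 ≤ q j := hρ.eigenvalues_nonneg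
  have hqs : ∑ j, q j = P := (trace_re_eq_sum_eigenvalues hρ.1).symm
  have hp0 : ∀ x, 0 ≤ (τ x).trace.re := fun x => trace_re_nonneg (hτ x)
  have hps : ∑ x, (τ x).trace.re = P := by rw [hP, ← hsum, trace_sum, Complex.re_sum]
  -- The diagonal of `τ x` in the eigenbasis of `ρ` is all that the cross term `tr τ log ρ` sees.
  set T : ι → n → ℝ := fun x j => ((Vᴴ * τ x * V) j j).re with hT
  have hT0 : ∀ x j, 0 ≤ T x j := fun x j =>
    (Complex.le_def.1 ((hτ x).conjTranspose_mul_mul_same V).diag_nonneg).1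
  have hTs : ∀ j, ∑ x, T x j = q j := by
    intro j
    have h1 : ∑ x, Vᴴ * τ x * V = diagonal (fun i => (q i : ℂ)) := by
      rw [← Finset.sum_mul, ← Finset.mul_sum, hsum]
      conv_lhs => rw [hρs]
      rw [← Matrix.mul_assoc, ← Matrix.mul_assoc, hV', Matrix.one_mul, Matrix.mul_assoc, hV',
        Matrix.mul_one]
    have h2 := congrArg Complex.re (congrFun (congrFun h1 j) j)
    rw [Matrix.sum_apply, Complex.re_sum, diagonal_apply_eq, Complex.ofReal_re] at h2
    exact h2
  have hTr : ∀ x, ∑ j, T x j = (τ x).trace.re := by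
    intro x
    have : (Vᴴ * τ x * V).trace = (τ x).trace := by
      rw [trace_mul_comm, ← Matrix.mul_assoc, hV, Matrix.one_mul]
    rw [← this, trace, Complex.re_sum]
    rfl
  have hTq : ∀ x j, q j = 0 → T x j = 0 := by
    intro x j h
    have h1 : T x j ≤ ∑ x, T x j :=
      Finset.single_le_sum (fun y _ => hT0 y j) (Finset.mem_univ x)
    rw [hTs, h] at h1
    exact le_antisymm h1 (hT0 x j)
  have key : ∀ x, t * ((A x * τ x).trace.re
        - (τ x).trace.re / P * (A x * ρ).trace.re) - (τ x).trace.re * t ^ 2 / 8 ≤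
      (τ x).trace.re * Real.log P - ∑ j, T x j * Real.log (q j) - homEntropy (hτ x).1 := by
    intro x
    obtain ⟨U, hU, hτs⟩ := exists_unitary_diagonalization (hτ x).1
    set p := (hτ x).1.eigenvalues with hp
    set s := (τ x).trace.re / P with hs
    have hpi : ∀ i, 0 ≤ p i := (hτ x).eigenvalues_nonneg
    have hpt : ∑ i, p i = (τ x).trace.re := (trace_re_eq_sum_eigenvalues (hτ x).1).symm
    have hP0 : 0 ≤ P := hps ▸ Finset.sum_nonneg fun x _ => hp0 x
    have hple : (τ x).trace.re ≤ P :=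
      hps ▸ Finset.single_le_sum (fun y _ => hp0 y) (Finset.mem_univ x)
    have hs0 : 0 ≤ s := div_nonneg (hp0 x) hP0
    -- If `P = 0`, division gives `s = 0`, and `0 ≤ tr (τ x) ≤ P` makes the identity hold anyway.
    have hsP : s * P = (τ x).trace.re := by
      rcases hP0.eq_or_lt with h | h
      · rw [← h, mul_zero]; exact le_antisymm (hp0 x) (hple.trans h.ge)
      · exact div_mul_cancel₀ _ h.ne'
    have hTW : ∀ j, T x j = ∑ i, ‖(Uᴴ * V) i j‖ ^ 2 * p i := by
      intro j
      rw [← conj_diagonal_diag_re, hT]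
      simp only
      rw [hτs, conjTranspose_mul, conjTranspose_conjTranspose]
      simp only [Matrix.mul_assoc]
    have hsupp : ∀ i j, s * q j = 0 → p i = 0 ∨ (Uᴴ * V) i j = 0 := by
      intro i j h
      have hz : T x j = 0 := by
        rcases mul_eq_zero.1 h with h | h
        · have h1 : ∑ j, T x j = 0 := by rw [hTr, ← hsP, h, zero_mul]
          exact (Finset.sum_eq_zero_iff_of_nonneg fun j _ => hT0 x j).1 h1 j (Finset.mem_univ j)
        · exact hTq x j h
      rw [hTW, Finset.sum_eq_zero_iff_of_nonneg fun i _ => mul_nonneg (by positivity) (hpi i)] at hz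
      rcases mul_eq_zero.1 (hz i (Finset.mem_univ i)) with h | h
      · exact Or.inr (by simpa using h)
      · exact Or.inl h
    -- The reference operator is `s ρ`, which has the trace of `τ x`. Their difference is traceless,
    -- so shifting `A x` by `1/2` costs nothing.
    have hpin := pinsker_dual hU hV hpi (q := fun j => s * q j)
      (fun j => mul_nonneg hs0 (hq0 j)) (by rw [← Finset.mul_sum, hqs, hpt, hsP]) hsupp
      (A := A x - (1 / 2 : ℂ) • 1)
      ((hA x).1.1.sub (by rw [IsHermitian, conjTranspose_smul, conjTranspose_one]; simp))
      (sub_half_sq_le (hA x).1 (hA x).2) t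
    have hsρ : V * diagonal (fun i => ((s * q i : ℝ) : ℂ)) * Vᴴ = (s : ℂ) • ρ := by
      have : diagonal (fun i => ((s * q i : ℝ) : ℂ)) = (s : ℂ) • diagonal fun i => (q i : ℂ) := by
        ext i j; by_cases h : i = j <;> simp [h]
      rw [this, Matrix.mul_smul, Matrix.smul_mul, ← hρs]
    have htr : ((A x - (1 / 2 : ℂ) • 1) * (τ x - (s : ℂ) • ρ)).trace.re
        = (A x * τ x).trace.re - s * (A x * ρ).trace.re := by
      simp only [Matrix.sub_mul, Matrix.mul_sub, Matrix.smul_mul, Matrix.mul_smul, Matrix.one_mul,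
        trace_sub, trace_smul, smul_eq_mul, Complex.sub_re, Complex.re_ofReal_mul]
      have h1 : ((1 / 2 : ℂ) * (τ x).trace).re = (τ x).trace.re / 2 := by
        rw [show (1 / 2 : ℂ) = ((1 / 2 : ℝ) : ℂ) by push_cast; rfl, Complex.re_ofReal_mul]; ring
      have h2 : ((1 / 2 : ℂ) * ρ.trace).re = P / 2 := by
        rw [show (1 / 2 : ℂ) = ((1 / 2 : ℝ) : ℂ) by push_cast; rfl, Complex.re_ofReal_mul]; ring
      rw [h1, h2]
      linear_combination hsP / 2
    rw [hsρ, ← hτs, htr, hpt] at hpin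
    refine hpin.trans (le_of_eq ?_)
    have hlog : ∑ j, (∑ i, ‖(Uᴴ * V) i j‖ ^ 2 * p i) * Real.log (s * q j)
        = (τ x).trace.re * Real.log s + ∑ j, T x j * Real.log (q j) := by
      rw [← hTr x, Finset.sum_mul, ← Finset.sum_add_distrib]
      refine Finset.sum_congr rfl fun j _ => ?_
      rw [← hTW, ← mul_add]
      by_cases h : T x j = 0
      · simp [h]
      · have hqj : q j ≠ 0 := fun h0 => h (hTq x j h0)
        have hsn : s ≠ 0 := fun h0 => h (by
          have h1 : ∑ j, T x j = 0 := by rw [hTr, ← hsP, h0, zero_mul]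
          exact (Finset.sum_eq_zero_iff_of_nonneg fun j _ => hT0 x j).1 h1 j (Finset.mem_univ j))
        rw [Real.log_mul hsn hqj]
    have hls : (τ x).trace.re * Real.log s
        = (τ x).trace.re * Real.log (τ x).trace.re - (τ x).trace.re * Real.log P := by
      by_cases h : (τ x).trace.re = 0
      · simp [h]
      · have : P ≠ 0 := fun h0 => h (le_antisymm (h0 ▸ hple) (hp0 x))
        rw [hs, Real.log_div h this, mul_sub]
    rw [hlog, hls, homEntropy]
    simp only [Real.negMulLog, neg_mul, Finset.sum_neg_distrib]
    ring
  refine (Finset.sum_le_sum fun x _ => key x).trans (le_of_eq ?_)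
  rw [Finset.sum_sub_distrib, Finset.sum_sub_distrib, ← Finset.sum_mul, hps, Finset.sum_comm]
  simp only [← Finset.sum_mul, hTs]
  rw [homEntropy]
  simp only [Real.negMulLog, neg_mul, Finset.sum_neg_distrib]
  ring

end QInfo

namespace QInfo

open Matrix

/-! ### Measuring the second tensor factor -/

section PartialMeasure

variable {N B : Type*} [Fintype N] [Fintype B]

/-- The unnormalized state on the first system after the measurement effect `E` has occurred on
the second system; for `E = 1` this is the partial trace over the second system. -/
def partialMeasure (Ω : Matrix (N × B) (N × B) ℂ) (E : Matrix B B ℂ) : Matrix N N ℂ :=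
  of fun a a' => ∑ b, ∑ b', E b' b * Ω (a, b) (a', b')

/-- The partial trace over the first system. -/
def traceLeft (Ω : Matrix (N × B) (N × B) ℂ) : Matrix B B ℂ :=
  of fun b b' => ∑ a, Ω (a, b) (a, b')

omit [Fintype N] in
theorem sum_partialMeasure {ι : Type*} (s : Finset ι) (Ω : Matrix (N × B) (N × B) ℂ)
    (E : ι → Matrix B B ℂ) :
    ∑ x ∈ s, partialMeasure Ω (E x) = partialMeasure Ω (∑ x ∈ s, E x) := by
  ext a a'
  simp only [Matrix.sum_apply, partialMeasure, of_apply, Finset.sum_mul]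
  rw [Finset.sum_comm]
  exact Finset.sum_congr rfl fun b _ => Finset.sum_comm

theorem trace_kronecker_mul (Ω : Matrix (N × B) (N × B) ℂ) (F : Matrix N N ℂ)
    (E : Matrix B B ℂ) : ((F ⊗ₖ E) * Ω).trace = (F * partialMeasure Ω E).trace := by
  simp only [trace, diag, mul_apply, partialMeasure, of_apply, kroneckerMap_apply,
    Fintype.sum_prod_type, Finset.mul_sum]
  refine Finset.sum_congr rfl fun a _ => ?_
  rw [Finset.sum_comm]
  refine Finset.sum_congr rfl fun a' _ => ?_
  rw [Finset.sum_comm]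
  exact Finset.sum_congr rfl fun b _ => Finset.sum_congr rfl fun b' _ => by ring

theorem trace_mul_traceLeft (Ω : Matrix (N × B) (N × B) ℂ) (E : Matrix B B ℂ) :
    (E * traceLeft Ω).trace = (partialMeasure Ω E).trace := by
  simp only [trace, diag, mul_apply, partialMeasure, of_apply, traceLeft, Finset.mul_sum]
  rw [Finset.sum_comm, Finset.sum_comm (s := (Finset.univ : Finset N))]
  refine Finset.sum_congr rfl fun b _ => ?_
  rw [Finset.sum_comm (s := (Finset.univ : Finset N))]

omit [Fintype B] in
theorem posSemidef_traceLeft {Ω : Matrix (N × B) (N × B) ℂ} (hΩ : Ω.PosSemidef) :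
    (traceLeft Ω).PosSemidef := by
  have : traceLeft Ω = ∑ a, Ω.submatrix (fun b => (a, b)) fun b => (a, b) := by
    ext b b'
    simp [traceLeft, Matrix.sum_apply]
  rw [this]
  exact posSemidef_sum _ fun a _ => hΩ.submatrix _

variable [DecidableEq B]

omit [Fintype N] in
theorem partialMeasure_one_apply (Ω : Matrix (N × B) (N × B) ℂ) (a a' : N) :
    partialMeasure Ω 1 a a' = ∑ b, Ω (a, b) (a', b) := by
  simp [partialMeasure, one_apply]

theorem trace_partialMeasure_one (Ω : Matrix (N × B) (N × B) ℂ) :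
    (partialMeasure Ω 1).trace = Ω.trace := by
  simp [trace, partialMeasure_one_apply, Fintype.sum_prod_type]

theorem trace_traceLeft (Ω : Matrix (N × B) (N × B) ℂ) : (traceLeft Ω).trace = Ω.trace := by
  rw [← trace_partialMeasure_one, ← trace_mul_traceLeft, Matrix.one_mul]

theorem posSemidef_partialMeasure {Ω : Matrix (N × B) (N × B) ℂ} (hΩ : Ω.PosSemidef)
    {E : Matrix B B ℂ} (hE : E.PosSemidef) : (partialMeasure Ω E).PosSemidef := by
  classical
  obtain ⟨W, rfl⟩ : ∃ W : Matrix B B ℂ, E = Wᴴ * W := by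
    obtain ⟨U, -, h⟩ := exists_unitary_diagonalization hE.1
    refine ⟨diagonal (fun i => (√(hE.1.eigenvalues i) : ℂ)) * Uᴴ, ?_⟩
    rw [conjTranspose_mul, conjTranspose_conjTranspose, diagonal_conjTranspose, Matrix.mul_assoc,
      ← Matrix.mul_assoc (diagonal _), diagonal_mul_diagonal, ← Matrix.mul_assoc]
    have hs : ∀ r : ℝ, 0 ≤ r → star (√r : ℂ) * (√r : ℂ) = (r : ℂ) := fun r hr => by
      rw [Complex.star_def, Complex.conj_ofReal]
      exact_mod_cast Real.mul_self_sqrt hr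
    simp only [Pi.star_apply, hs _ (hE.eigenvalues_nonneg _)]
    exact h
  -- Kraus operators: the identity tensored with the `l`-th row of `W`.
  set K : B → Matrix N (N × B) ℂ := fun l => of fun a x => if a = x.1 then W l x.2 else 0
  have : partialMeasure Ω (Wᴴ * W) = ∑ l, K l * Ω * (K l)ᴴ := by
    ext a a'
    simp only [Matrix.sum_apply, partialMeasure, of_apply, mul_apply, conjTranspose_apply, K,
      Fintype.sum_prod_type, ite_mul, zero_mul, Finset.sum_ite_irrel, Finset.sum_const_zero,
      Finset.sum_ite_eq, Finset.mem_univ, if_true, apply_ite star, star_zero, mul_ite, mul_zero,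
      Finset.sum_mul]
    rw [Finset.sum_comm]
    refine (Finset.sum_congr rfl fun b' _ => Finset.sum_comm).trans ?_
    rw [Finset.sum_comm]
    refine Finset.sum_congr rfl fun l _ => Finset.sum_congr rfl fun b' _ =>
      Finset.sum_congr rfl fun b _ => by ring
  rw [this]
  exact posSemidef_sum _ fun l _ => hΩ.mul_mul_conjTranspose_same _

end PartialMeasure

/-! ### Peeling off the first `B` system -/

section Marginal

variable {dA dB k : ℕ}

/-- The first of the systems `B` of an operator on `A ⊗ B^(k+1)`, moved to the last position. -/
def splitFirst (π : Matrix (Fin dA × (Fin (k + 1) → Fin dB)) (Fin dA × (Fin (k + 1) → Fin dB)) ℂ) :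
    Matrix ((Fin dA × (Fin k → Fin dB)) × Fin dB) ((Fin dA × (Fin k → Fin dB)) × Fin dB) ℂ :=
  π.submatrix (fun x => (x.1.1, Fin.cons x.2 x.1.2)) fun x => (x.1.1, Fin.cons x.2 x.1.2)

theorem sum_pi_fin_succ {M : Type*} [AddCommMonoid M] (f : (Fin (k + 1) → Fin dB) → M) :
    ∑ c, f c = ∑ b, ∑ c : Fin k → Fin dB, f (Fin.cons b c) := by
  rw [← Fintype.sum_prod_type']
  exact (Fintype.sum_equiv (Fin.consEquiv fun _ => Fin dB) _ _ fun _ => rfl).symm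

theorem marginal_zero_eq
    (π : Matrix (Fin dA × (Fin (k + 1) → Fin dB)) (Fin dA × (Fin (k + 1) → Fin dB)) ℂ) :
    marginal π 0 = ∑ c : Fin k → Fin dB, π.submatrix
      (fun x : Fin dA × Fin dB => (x.1, (Fin.cons x.2 c : Fin (k + 1) → Fin dB)))
      (fun x : Fin dA × Fin dB => (x.1, (Fin.cons x.2 c : Fin (k + 1) → Fin dB))) := by
  ext x y
  simp only [marginal, of_apply, sum_pi_fin_succ, Fin.cons_zero, Fin.update_cons_zero,
    Matrix.sum_apply, submatrix_apply, Finset.sum_ite_irrel, Finset.sum_const_zero,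
    Finset.sum_ite_eq', Finset.mem_univ, if_true]

theorem posSemidef_marginal_zero
    {π : Matrix (Fin dA × (Fin (k + 1) → Fin dB)) (Fin dA × (Fin (k + 1) → Fin dB)) ℂ}
    (hπ : π.PosSemidef) : (marginal π 0).PosSemidef := by
  rw [marginal_zero_eq]
  exact posSemidef_sum _ fun c _ => hπ.submatrix _

theorem partialMeasure_marginal_zero
    (π : Matrix (Fin dA × (Fin (k + 1) → Fin dB)) (Fin dA × (Fin (k + 1) → Fin dB)) ℂ)
    (E : Matrix (Fin dB) (Fin dB) ℂ) :
    partialMeasure (marginal π 0) E = partialMeasure (partialMeasure (splitFirst π) E) 1 := by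
  ext a a'
  rw [partialMeasure_one_apply, marginal_zero_eq]
  simp only [partialMeasure, of_apply, splitFirst, submatrix_apply, Matrix.sum_apply,
    Finset.mul_sum]
  symm
  rw [Finset.sum_comm]
  exact Finset.sum_congr rfl fun b _ => Finset.sum_comm

theorem partialMeasure_marginal_zero_one
    (π : Matrix (Fin dA × (Fin (k + 1) → Fin dB)) (Fin dA × (Fin (k + 1) → Fin dB)) ℂ) :
    partialMeasure (marginal π 0) 1 = partialMeasure π 1 := by
  ext a a'
  simp only [partialMeasure_one_apply, marginal_zero_eq, Matrix.sum_apply, submatrix_apply,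
    sum_pi_fin_succ]

theorem sum_marginal {ι : Type*} (s : Finset ι)
    (π : ι → Matrix (Fin dA × (Fin k → Fin dB)) (Fin dA × (Fin k → Fin dB)) ℂ) (j : Fin k) :
    ∑ x ∈ s, marginal (π x) j = marginal (∑ x ∈ s, π x) j := by
  ext x y
  simp only [marginal, of_apply, Matrix.sum_apply]
  rw [Finset.sum_comm]
  refine Finset.sum_congr rfl fun c _ => ?_
  split_ifs <;> simp

theorem marginal_partialMeasure_splitFirst
    (π : Matrix (Fin dA × (Fin (k + 1) → Fin dB)) (Fin dA × (Fin (k + 1) → Fin dB)) ℂ)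
    (j : Fin k) : marginal (partialMeasure (splitFirst π) 1) j = marginal π j.succ := by
  ext x y
  simp only [marginal, of_apply, partialMeasure_one_apply, splitFirst, submatrix_apply,
    sum_pi_fin_succ, Fin.cons_succ, ← Fin.cons_update]
  rw [Finset.sum_comm]
  refine Finset.sum_congr rfl fun c _ => ?_
  split_ifs <;> simp

end Marginal

/-! ### The separable cone -/

section Separable

open scoped NNReal

variable {dA dB : ℕ}

/-- The cone of unnormalized separable states. -/
noncomputable def sepCone (dA dB : ℕ) :
    Submodule ℝ≥0 (Matrix (Fin dA × Fin dB) (Fin dA × Fin dB) ℂ) :=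
  Submodule.span ℝ≥0 {τ | IsPureProduct τ}

theorem smul_mem_sepCone {c : ℝ} (hc : 0 ≤ c) {σ : Matrix (Fin dA × Fin dB) (Fin dA × Fin dB) ℂ}
    (h : σ ∈ sepCone dA dB) : c • σ ∈ sepCone dA dB :=
  (sepCone dA dB).smul_mem (⟨c, hc⟩ : ℝ≥0) h

theorem IsPureProduct.trace_eq_one {σ : Matrix (Fin dA × Fin dB) (Fin dA × Fin dB) ℂ}
    (h : IsPureProduct σ) : σ.trace = 1 := by
  obtain ⟨ψ, φ, hψ, hφ, rfl⟩ := h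
  rw [trace_kronecker, trace_vecMulVec, trace_vecMulVec, dotProduct_comm, hψ, dotProduct_comm, hφ,
    one_mul]

theorem isSeparable_of_mem_sepCone {σ : Matrix (Fin dA × Fin dB) (Fin dA × Fin dB) ℂ}
    (h : σ ∈ sepCone dA dB) (htr : σ.trace = 1) : IsSeparable σ := by
  obtain ⟨m, f, g, rfl⟩ := Submodule.mem_span_set'.1 h
  have hf : ∑ i, (f i : ℝ) = 1 := by
    have := congrArg Complex.re htr
    rw [trace_sum, Complex.re_sum] at this
    simp only [trace_smul, (g _).2.trace_eq_one] at this
    simpa [NNReal.smul_def] using this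
  exact (convex_convexHull ℝ _).sum_mem (fun i _ => (f i).2) hf
    fun i _ => subset_convexHull ℝ _ (g i).2

/-- Spectral decomposition of both factors exhibits the product as a nonnegative combination of pure
products. -/
theorem kronecker_mem_sepCone {X : Matrix (Fin dA) (Fin dA) ℂ} {Y : Matrix (Fin dB) (Fin dB) ℂ}
    (hX : X.PosSemidef) (hY : Y.PosSemidef) : X ⊗ₖ Y ∈ sepCone dA dB := by
  obtain ⟨U, hU, hXs⟩ := exists_unitary_diagonalization hX.1
  obtain ⟨V, hV, hYs⟩ := exists_unitary_diagonalization hY.1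
  set p := hX.1.eigenvalues
  set q := hY.1.eigenvalues
  have e : X ⊗ₖ Y = ∑ i, ∑ j, (p i * q j) •
      (vecMulVec (U.col i) (star (U.col i)) ⊗ₖ vecMulVec (V.col j) (star (V.col j))) := by
    ext x y
    rw [kroneckerMap_apply, hXs, hYs, mul_apply, mul_apply]
    simp only [Matrix.sum_apply, Matrix.smul_apply, kroneckerMap_apply, mul_diagonal,
      conjTranspose_apply, vecMulVec_apply, Matrix.col_apply, Pi.star_apply, Finset.sum_mul_sum,
      Complex.real_smul, Complex.ofReal_mul]
    exact Finset.sum_congr rfl fun i _ => Finset.sum_congr rfl fun j _ => by ring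
  have hcol : ∀ {d : ℕ} {U : Matrix (Fin d) (Fin d) ℂ}, U * Uᴴ = 1 → ∀ i,
      star (U.col i) ⬝ᵥ U.col i = 1 := by
    intro d U hU i
    have hU' : Uᴴ * U = 1 := mul_eq_one_comm.1 hU
    have := congrFun (congrFun hU' i) i
    rwa [mul_apply, one_apply_eq] at this
  rw [e]
  refine sum_mem fun i _ => sum_mem fun j _ => smul_mem_sepCone
    (mul_nonneg (hX.eigenvalues_nonneg i) (hY.eigenvalues_nonneg j)) (Submodule.subset_span ?_)
  exact ⟨_, _, hcol hU i, hcol hV j, rfl⟩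

end Separable

end QInfo

/-! ### Sequential measurement and the bound for one measurement -/

namespace QInfo

open Matrix

variable {dA dB : ℕ}

/-- Measuring the systems `B` one after the other: the gains in the entropy of `A` control the
distance from separable states, summed over the `k` marginals. -/
theorem exists_sepCone_sum_le {m : ℕ} {A : Fin m → Matrix (Fin dA) (Fin dA) ℂ}
    {E : Fin m → Matrix (Fin dB) (Fin dB) ℂ}
    (hA : ∀ x, (A x).PosSemidef ∧ (1 - A x).PosSemidef) (hE : ∀ x, (E x).PosSemidef)
    (hE1 : ∑ x, E x = 1) :
    ∀ (k : ℕ) (π : Matrix (Fin dA × (Fin k → Fin dB)) (Fin dA × (Fin k → Fin dB)) ℂ)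
      (hπ : π.PosSemidef),
      ∃ σ : Fin k → Matrix (Fin dA × Fin dB) (Fin dA × Fin dB) ℂ,
        (∀ j, σ j ∈ sepCone dA dB) ∧ (∀ j, (σ j).trace = π.trace) ∧
        ∀ t : ℝ, ∑ j, (t * ((∑ x, A x ⊗ₖ E x) * (marginal π j - σ j)).trace.re
          - π.trace.re * t ^ 2 / 8) ≤
            homEntropy (posSemidef_partialMeasure hπ PosSemidef.one).1 := by
  intro k
  induction k with
  | zero =>
    intro π hπ
    exact ⟨fun _ => 0, fun j => j.elim0, fun j => j.elim0, fun t => by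
      simpa using homEntropy_nonneg (posSemidef_partialMeasure hπ PosSemidef.one)⟩
  | succ k ih =>
    intro π hπ
    have hΩ := posSemidef_marginal_zero hπ
    set Ω := marginal π 0 with hΩdef
    have hsplit : (splitFirst π).PosSemidef := hπ.submatrix _
    have hπx : ∀ x, (partialMeasure (splitFirst π) (E x)).PosSemidef := fun x =>
      posSemidef_partialMeasure hsplit (hE x)
    -- The induction hypothesis is applied to the unnormalized state after each outcome; homogeneity
    -- of the entropy spares any conditioning on positive probability.
    choose σ hσ hσtr hσt using fun x => ih _ (hπx x)
    have hρ : (partialMeasure π 1).PosSemidef := posSemidef_partialMeasure hπ PosSemidef.one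
    have hρΩ : partialMeasure Ω 1 = partialMeasure π 1 := partialMeasure_marginal_zero_one π
    have hΩtr : Ω.trace = π.trace := by
      rw [← trace_partialMeasure_one Ω, hρΩ, trace_partialMeasure_one]
    have hτ : ∀ x, (partialMeasure Ω (E x)).PosSemidef := fun x =>
      posSemidef_partialMeasure hΩ (hE x)
    have hτx : ∀ x, partialMeasure (partialMeasure (splitFirst π) (E x)) 1
        = partialMeasure Ω (E x) := fun x => (partialMeasure_marginal_zero π (E x)).symm
    have hτtr : ∀ x, (partialMeasure (splitFirst π) (E x)).trace
        = (partialMeasure Ω (E x)).trace := fun x => by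
      rw [← hτx, trace_partialMeasure_one]
    have hτsum : ∑ x, partialMeasure Ω (E x) = partialMeasure π 1 := by
      rw [sum_partialMeasure, hE1, hρΩ]
    have htrsum : ∑ x, (partialMeasure Ω (E x)).trace = π.trace := by
      rw [← trace_sum, hτsum, trace_partialMeasure_one]
    have hPr : π.trace = (π.trace.re : ℂ) :=
      Complex.ext rfl (Complex.le_def.1 hπ.trace_nonneg).2.symm
    set P := π.trace.re with hP
    -- The first system gets the normalized product of the marginals of `Ω`; each later one gets the
    -- sum over outcomes of the states from the induction hypothesis.
    refine ⟨Fin.cons (P⁻¹ • (partialMeasure π 1 ⊗ₖ traceLeft Ω)) fun j => ∑ x, σ x j,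
      ?_, ?_, ?_⟩
    · intro j
      refine Fin.cases ?_ (fun j => ?_) j
      · exact smul_mem_sepCone (inv_nonneg.2 (trace_re_nonneg hπ))
          (kronecker_mem_sepCone hρ (posSemidef_traceLeft hΩ))
      · rw [Fin.cons_succ]
        exact sum_mem fun x _ => hσ x j
    · intro j
      refine Fin.cases ?_ (fun j => ?_) j
      · rw [Fin.cons_zero, trace_smul, trace_kronecker, trace_partialMeasure_one, trace_traceLeft,
          hΩtr, hPr, Complex.real_smul, ← Complex.ofReal_mul, ← Complex.ofReal_mul]
        by_cases h : P = 0
        · simp [h]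
        · rw [inv_mul_cancel_left₀ h]
      · rw [Fin.cons_succ, trace_sum]
        simp only [hσtr, hτtr]
        exact htrsum
    · intro t
      have h0 := sum_le_homEntropy_sub hτ hρ hτsum hA t
      have hM0 : ((∑ x, A x ⊗ₖ E x) * (Ω - P⁻¹ • (partialMeasure π 1 ⊗ₖ traceLeft Ω))).trace.re
          = ∑ x, ((A x * partialMeasure Ω (E x)).trace.re
            - (partialMeasure Ω (E x)).trace.re / P * (A x * partialMeasure π 1).trace.re) := by
        rw [Finset.sum_mul, trace_sum, Complex.re_sum]
        refine Finset.sum_congr rfl fun x _ => ?_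
        have hre : ((partialMeasure Ω (E x)).trace : ℂ) = ((partialMeasure Ω (E x)).trace.re : ℂ) :=
          Complex.ext rfl (Complex.le_def.1 (hτ x).trace_nonneg).2.symm
        rw [Matrix.mul_sub, trace_sub, Complex.sub_re, trace_kronecker_mul, Matrix.mul_smul,
          trace_smul, ← mul_kronecker_mul, trace_kronecker, trace_mul_traceLeft, hre,
          Complex.real_smul, Complex.re_ofReal_mul, Complex.re_mul_ofReal, Complex.ofReal_re]
        ring
      -- Summing over Bob's outcomes on the first system restores the undisturbed later marginals,
      -- as `∑ x, E x = 1`.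
      have hsucc : ∀ j : Fin k, ((∑ x, A x ⊗ₖ E x) * (marginal π j.succ - ∑ x, σ x j)).trace.re
          = ∑ x, ((∑ x, A x ⊗ₖ E x) *
            (marginal (partialMeasure (splitFirst π) (E x)) j - σ x j)).trace.re := by
        intro j
        rw [← marginal_partialMeasure_splitFirst, ← hE1, ← sum_partialMeasure, ← sum_marginal,
          ← Finset.sum_sub_distrib, Finset.mul_sum, trace_sum, Complex.re_sum]
      have hPsum : ∑ x, (partialMeasure Ω (E x)).trace.re = P := by
        rw [← Complex.re_sum, htrsum]
      have hIH : ∑ x, ∑ j, (t * ((∑ x, A x ⊗ₖ E x) *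
            (marginal (partialMeasure (splitFirst π) (E x)) j - σ x j)).trace.re
            - (partialMeasure Ω (E x)).trace.re * t ^ 2 / 8) ≤ ∑ x, homEntropy (hτ x).1 := by
        refine Finset.sum_le_sum fun x _ => ?_
        have := hσt x t
        simp only [hτtr, hτx] at this
        exact this
      rw [Fin.sum_univ_succ]
      simp only [Fin.cons_zero, Fin.cons_succ]
      rw [← hΩdef, hM0]
      rw [trace_partialMeasure_one, ← hP] at h0
      have e1 : ∑ x, (t * ((A x * partialMeasure Ω (E x)).trace.re
            - (partialMeasure Ω (E x)).trace.re / P * (A x * partialMeasure π 1).trace.re)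
            - (partialMeasure Ω (E x)).trace.re * t ^ 2 / 8)
          = t * ∑ x, ((A x * partialMeasure Ω (E x)).trace.re
            - (partialMeasure Ω (E x)).trace.re / P * (A x * partialMeasure π 1).trace.re)
            - P * t ^ 2 / 8 := by
        rw [Finset.sum_sub_distrib, ← Finset.mul_sum, ← Finset.sum_div, ← Finset.sum_mul, hPsum]
      have e2 : ∑ j : Fin k, (t * ((∑ x, A x ⊗ₖ E x) *
            (marginal π j.succ - ∑ x, σ x j)).trace.re - P * t ^ 2 / 8)
          = ∑ x, ∑ j, (t * ((∑ x, A x ⊗ₖ E x) *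
            (marginal (partialMeasure (splitFirst π) (E x)) j - σ x j)).trace.re
            - (partialMeasure Ω (E x)).trace.re * t ^ 2 / 8) := by
        rw [Finset.sum_comm]
        refine Finset.sum_congr rfl fun j _ => ?_
        rw [hsucc, Finset.sum_sub_distrib, ← Finset.mul_sum, ← Finset.sum_div, ← Finset.sum_mul,
          hPsum]
      rw [e2]
      linarith

/-- The de Finetti bound for one measurement, without absolute values. -/
theorem exists_isSeparable_trace_le {k : ℕ} (hk : 1 ≤ k)
    {ρ : Matrix (Fin dA × Fin dB) (Fin dA × Fin dB) ℂ} (hρ : IsExtendible k ρ)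
    {M : Matrix (Fin dA × Fin dB) (Fin dA × Fin dB) ℂ} (hM : IsOneLOCC M) :
    ∃ σ, IsSeparable σ ∧ (M * (ρ - σ)).trace.re ≤ √(Real.log dA / (2 * k)) := by
  obtain ⟨π, hπ, hmarg⟩ := hρ
  obtain ⟨m, A, E, hA, hE, hE1, rfl⟩ := hM
  obtain ⟨σ, hσ, hσtr, hσt⟩ := exists_sepCone_sum_le hA hE hE1 k π hπ.1
  have hk0 : (0 : ℝ) < k := by exact_mod_cast hk
  have htr : ((k : ℝ)⁻¹ • ∑ j, σ j).trace = 1 := by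
    rw [trace_smul, trace_sum]
    simp only [hσtr, hπ.2, Finset.sum_const, Finset.card_univ, Fintype.card_fin, nsmul_eq_mul,
      mul_one]
    rw [Complex.real_smul, Complex.ofReal_inv, Complex.ofReal_natCast,
      inv_mul_cancel₀ (by exact_mod_cast hk0.ne')]
  refine ⟨(k : ℝ)⁻¹ • ∑ j, σ j, isSeparable_of_mem_sepCone
    (smul_mem_sepCone (inv_nonneg.2 hk0.le) (sum_mem fun j _ => hσ j)) htr, ?_⟩
  set M := ∑ x, A x ⊗ₖ E x
  set a := (M * (ρ - (k : ℝ)⁻¹ • ∑ j, σ j)).trace.re with ha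
  have hsum : ∑ j, (M * (ρ - σ j)).trace.re = k * a := by
    rw [ha, ← Complex.re_ofReal_mul, Complex.ofReal_natCast, ← nsmul_eq_mul, ← trace_smul,
      ← Matrix.mul_smul, ← Complex.re_sum, ← trace_sum, ← Finset.mul_sum, smul_sub,
      Finset.sum_sub_distrib, Finset.sum_const, Finset.card_univ, Fintype.card_fin,
      ← Nat.cast_smul_eq_nsmul ℝ k (_ • _), smul_smul, mul_inv_cancel₀ hk0.ne', one_smul]
  -- `t = 4a` maximizes `k (t a - t² / 8)`, with value `2 k a²`. This needs `σ` to be chosen before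
  -- `t`.
  have h := (hσt (4 * a)).trans (homEntropy_le_log_card (posSemidef_partialMeasure hπ.1 PosSemidef.one)
    (by rw [trace_partialMeasure_one, hπ.2]))
  simp only [hmarg, hπ.2, Complex.one_re, Finset.sum_sub_distrib, ← Finset.mul_sum, hsum,
    Finset.sum_const, Finset.card_univ, Fintype.card_fin, nsmul_eq_mul] at h
  refine Real.le_sqrt_of_sq_le ?_
  rw [le_div_iff₀ (by positivity)]
  linarith

/-! ### Compactness, convexity and minimax -/

section Compact

variable {F : Type*} [AddCommGroup F] [Module ℝ F] [FiniteDimensional ℝ F] [TopologicalSpace F]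
  [ContinuousAdd F] [ContinuousSMul ℝ F]

/-- In finite dimensions the convex hull of a compact set is compact. -/
theorem isCompact_convexHull_of_isCompact {s : Set F} (hs : IsCompact s) :
    IsCompact (convexHull ℝ s) := by
  rcases s.eq_empty_or_nonempty with rfl | ⟨x₀, hx₀⟩
  · simp
  set N := Module.finrank ℝ F + 1
  have hK : IsCompact (stdSimplex ℝ (Fin N) ×ˢ Set.univ.pi fun _ : Fin N => s) :=
    (isCompact_stdSimplex ℝ (Fin N)).prod (isCompact_univ_pi fun _ => hs)
  have hc : Continuous fun y : (Fin N → ℝ) × (Fin N → F) => ∑ i, y.1 i • y.2 i := by fun_prop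
  convert hK.image hc using 1
  refine Set.Subset.antisymm (fun x hx => ?_) ?_
  · obtain ⟨ι, _, z, w, hz, haff, hw, hw1, rfl⟩ := eq_pos_convex_span_of_mem_convexHull hx
    have hcard : Fintype.card ι ≤ Fintype.card (Fin N) := by
      rw [Fintype.card_fin]
      exact haff.card_le_finrank_succ.trans (Nat.succ_le_succ (Submodule.finrank_le _))
    obtain ⟨e⟩ := Function.Embedding.nonempty_of_card_le hcard
    -- Carathéodory bounds the number of points by `N`; shorter combinations are padded with `x₀` at
    -- weight zero.
    refine ⟨(Function.extend e w 0, Function.extend e z fun _ => x₀), ⟨⟨fun i => ?_, ?_⟩, ?_⟩, ?_⟩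
    · by_cases h : ∃ a, e a = i
      · obtain ⟨a, rfl⟩ := h
        simpa only [e.injective.extend_apply] using (hw a).le
      · simp only [Function.extend_apply' _ _ _ h, Pi.zero_apply, le_refl]
    · rw [← hw1]
      refine (Fintype.sum_of_injective e e.injective _ _ (fun i hi => ?_) fun a => ?_).symm
      · exact Function.extend_apply' _ _ _ hi
      · simp only [e.injective.extend_apply]
    · intro i _
      by_cases h : ∃ a, e a = i
      · obtain ⟨a, rfl⟩ := h
        simp only [e.injective.extend_apply]
        exact hz ⟨a, rfl⟩
      · simp only [Function.extend_apply' _ _ _ h]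
        exact hx₀
    · refine (Fintype.sum_of_injective e e.injective _ _ (fun i hi => ?_) fun a => ?_).symm
      · simp only [Function.extend_apply' _ _ _ hi, Pi.zero_apply, zero_smul]
      · simp only [e.injective.extend_apply]
  · rintro _ ⟨⟨w, z⟩, ⟨hw, hz⟩, rfl⟩
    exact (convex_convexHull ℝ s).sum_mem (fun i _ => hw.1 i) hw.2
      fun i hi => subset_convexHull ℝ s (hz i (Set.mem_univ i))

end Compact

theorem isCompact_unitVectors (d : ℕ) : IsCompact {ψ : Fin d → ℂ | star ψ ⬝ᵥ ψ = 1} := by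
  have hcl : IsClosed {ψ : Fin d → ℂ | star ψ ⬝ᵥ ψ = 1} :=
    isClosed_eq (by simp only [dotProduct]; fun_prop) continuous_const
  refine Metric.isCompact_of_isClosed_isBounded hcl
    ((Metric.isBounded_closedBall (x := (0 : Fin d → ℂ)) (r := 1)).subset fun ψ hψ => ?_)
  rw [mem_closedBall_zero_iff, pi_norm_le_iff_of_nonneg zero_le_one]
  intro i
  have h1 : ∑ i, ‖ψ i‖ ^ 2 = 1 := by
    have := congrArg Complex.re (show star ψ ⬝ᵥ ψ = 1 from hψ)
    simp only [dotProduct, Complex.re_sum, Pi.star_apply, Complex.star_def] at this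
    rw [← Complex.one_re, ← this]
    refine Finset.sum_congr rfl fun i _ => ?_
    rw [mul_comm, Complex.mul_conj, Complex.normSq_eq_norm_sq, Complex.ofReal_re]
  have h2 : ‖ψ i‖ ^ 2 ≤ 1 := h1 ▸ Finset.single_le_sum
    (f := fun i => ‖ψ i‖ ^ 2) (fun j _ => by positivity) (Finset.mem_univ i)
  exact (sq_le_one_iff₀ (norm_nonneg _)).1 h2

theorem isCompact_isSeparable : IsCompact
    {σ : Matrix (Fin dA × Fin dB) (Fin dA × Fin dB) ℂ | IsSeparable σ} := by
  refine isCompact_convexHull_of_isCompact ?_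
  have hc : Continuous fun y : (Fin dA → ℂ) × (Fin dB → ℂ) =>
      vecMulVec y.1 (star y.1) ⊗ₖ vecMulVec y.2 (star y.2) := by
    refine continuous_matrix fun i j => ?_
    simp only [kroneckerMap_apply, vecMulVec_apply, Pi.star_apply]
    fun_prop
  convert ((isCompact_unitVectors dA).prod (isCompact_unitVectors dB)).image hc using 1
  ext τ
  constructor
  · rintro ⟨ψ, φ, hψ, hφ, rfl⟩
    exact ⟨(ψ, φ), ⟨hψ, hφ⟩, rfl⟩
  · rintro ⟨⟨ψ, φ⟩, ⟨hψ, hφ⟩, rfl⟩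
    exact ⟨ψ, φ, hψ, hφ, rfl⟩

theorem IsOneLOCC.one_sub {M : Matrix (Fin dA × Fin dB) (Fin dA × Fin dB) ℂ} (h : IsOneLOCC M) :
    IsOneLOCC (1 - M) := by
  obtain ⟨m, A, E, hA, hE, hE1, rfl⟩ := h
  refine ⟨m, fun x => 1 - A x, E, fun x => ⟨(hA x).2, by simpa using (hA x).1⟩, hE, hE1, ?_⟩
  have : (1 : Matrix (Fin dA × Fin dB) (Fin dA × Fin dB) ℂ) = ∑ x, (1 : Matrix _ _ ℂ) ⊗ₖ E x := by
    ext i j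
    rw [← one_kronecker_one, ← hE1]
    simp [Matrix.sum_apply, Finset.mul_sum]
  rw [this, ← Finset.sum_sub_distrib]
  refine Finset.sum_congr rfl fun x _ => ?_
  ext i j
  simp [sub_mul]

/-- Bob tosses a biased coin to choose between the two protocols and includes the result in his
message. -/
theorem convex_isOneLOCC :
    Convex ℝ {M : Matrix (Fin dA × Fin dB) (Fin dA × Fin dB) ℂ | IsOneLOCC M} := by
  rintro _ ⟨m, A, E, hA, hE, hE1, rfl⟩ _ ⟨m', A', E', hA', hE', hE1', rfl⟩ a b ha hb hab
  refine ⟨m + m', Fin.append A A', Fin.append (fun x => (a : ℂ) • E x) fun x => (b : ℂ) • E' x,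
    fun x => ?_, fun x => ?_, ?_, ?_⟩
  · refine Fin.addCases (fun x => ?_) (fun x => ?_) x
    · rw [Fin.append_left]; exact hA x
    · rw [Fin.append_right]; exact hA' x
  · refine Fin.addCases (fun x => ?_) (fun x => ?_) x
    · rw [Fin.append_left]; exact (hE x).smul (by exact_mod_cast ha)
    · rw [Fin.append_right]; exact (hE' x).smul (by exact_mod_cast hb)
  · simp only [Fin.sum_univ_add, Fin.append_left, Fin.append_right, ← Finset.smul_sum, hE1, hE1']
    rw [← add_smul, ← Complex.ofReal_add, hab, Complex.ofReal_one, one_smul]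
  · simp only [Fin.sum_univ_add, Fin.append_left, Fin.append_right, kronecker_smul,
      ← Finset.smul_sum]
    rfl

theorem isOneLOCC_zero : IsOneLOCC (0 : Matrix (Fin dA × Fin dB) (Fin dA × Fin dB) ℂ) :=
  ⟨1, fun _ => 0, fun _ => 1, fun _ => ⟨PosSemidef.zero, by simpa using PosSemidef.one⟩,
    fun _ => PosSemidef.one, by simp, by simp⟩

/-- By the minimax theorem the separable state can be chosen independently of the measurement. -/
theorem exists_isSeparable_forall_trace_le {ρ : Matrix (Fin dA × Fin dB) (Fin dA × Fin dB) ℂ}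
    {ε : ℝ} (h : ∀ M, IsOneLOCC M → ∃ σ, IsSeparable σ ∧ (M * (ρ - σ)).trace.re ≤ ε) :
    ∃ σ, IsSeparable σ ∧ ∀ M, IsOneLOCC M → (M * (ρ - σ)).trace.re ≤ ε := by
  by_contra! hcon
  set f : Matrix (Fin dA × Fin dB) (Fin dA × Fin dB) ℂ →
    Matrix (Fin dA × Fin dB) (Fin dA × Fin dB) ℂ → ℝ := fun σ M => (M * (ρ - σ)).trace.re
  have hcσ : ∀ M, Continuous fun σ => f σ M := fun M => by
    refine Complex.continuous_re.comp (Continuous.matrix_trace ?_)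
    fun_prop
  have hcM : ∀ σ, Continuous fun M => f σ M := fun σ => by
    refine Complex.continuous_re.comp (Continuous.matrix_trace ?_)
    fun_prop
  have hneX : {σ : Matrix (Fin dA × Fin dB) (Fin dA × Fin dB) ℂ | IsSeparable σ}.Nonempty :=
    let ⟨σ, hσ, _⟩ := h 0 isOneLOCC_zero
    ⟨σ, hσ⟩
  -- Pointwise failure only says that each `σ` is beaten by some `M`. Compactness reduces this to
  -- finitely many `M`, the form of strict inequality that Sion's theorem is given here.
  obtain ⟨s, hcover⟩ := isCompact_isSeparable.elim_finite_subcover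
    (fun M : {M : Matrix (Fin dA × Fin dB) (Fin dA × Fin dB) ℂ // IsOneLOCC M} =>
      {σ | ε < f σ M}) (fun M => isOpen_lt continuous_const (hcσ M)) (fun σ hσ => by
        obtain ⟨M, hM, hlt⟩ := hcon σ hσ
        exact Set.mem_iUnion.2 ⟨⟨M, hM⟩, hlt⟩)
  have hfσ : ∀ M σ σ' (a b : ℝ), a + b = 1 → f (a • σ + b • σ') M = a * f σ M + b * f σ' M := by
    intro M σ σ' a b hab
    have : ρ - (a • σ + b • σ') = a • (ρ - σ) + b • (ρ - σ') := by
      conv_lhs => rw [← one_smul ℝ ρ, ← hab]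
      module
    simp only [f, this, Matrix.mul_add, Matrix.mul_smul, trace_add, trace_smul, Complex.add_re,
      Complex.smul_re, smul_eq_mul]
  have hfM : ∀ σ M M' (a b : ℝ), f σ (a • M + b • M') = a * f σ M + b * f σ M' := by
    intro σ M M' a b
    simp only [f, Matrix.add_mul, Matrix.smul_mul, trace_add, trace_smul, Complex.add_re,
      Complex.smul_re, smul_eq_mul]
  obtain ⟨M₀, hM₀, hlt⟩ := Sion.exists_lt_iInf_of_lt_iInf_of_finite (f := f) (t := ε)
    (ne_X := hneX) (kX := isCompact_isSeparable) (cX := convex_convexHull ℝ _)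
    (cY := convex_isOneLOCC) (fun M _ => (hcσ M).lowerSemicontinuous.lowerSemicontinuousOn _)
    (fun M _ => ConvexOn.quasiconvexOn ⟨convex_convexHull ℝ _,
      fun σ _ σ' _ a b _ _ hab => (hfσ M σ σ' a b hab).le⟩)
    (hfx := fun σ _ => (hcM σ).upperSemicontinuous.upperSemicontinuousOn _)
    (hfx' := fun σ _ => ConcaveOn.quasiconcaveOn ⟨convex_isOneLOCC,
      fun M _ M' _ a b _ _ _ => (hfM σ M M' a b).ge⟩)
    (s := Subtype.val '' (s : Set {M // IsOneLOCC M})) (hs := s.finite_toSet.image _)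
    (hsY := by rintro _ ⟨M, -, rfl⟩; exact M.2)
    (ht := fun σ hσ => by
      obtain ⟨M, hM, hlt⟩ := Set.mem_iUnion₂.1 (hcover hσ)
      exact ⟨M, ⟨M, hM, rfl⟩, hlt⟩)
  obtain ⟨σ, hσ, hle⟩ := h M₀ hM₀
  exact (hlt σ hσ).not_ge hle

/-! ### Two-sided bounds and the final constants -/

theorem IsSeparable.isHermitian_and_trace {σ : Matrix (Fin dA × Fin dB) (Fin dA × Fin dB) ℂ}
    (h : IsSeparable σ) : σ.IsHermitian ∧ σ.trace = 1 := by
  have hconv : Convex ℝ {σ : Matrix (Fin dA × Fin dB) (Fin dA × Fin dB) ℂ |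
      σ.IsHermitian ∧ σ.trace = 1} := by
    rintro σ ⟨hσ, hσ1⟩ σ' ⟨hσ', hσ1'⟩ a b - - hab
    refine ⟨?_, ?_⟩
    · rw [IsHermitian, conjTranspose_add, conjTranspose_smul, conjTranspose_smul, hσ.eq, hσ'.eq]
      simp
    · rw [trace_add, trace_smul, trace_smul, hσ1, hσ1', ← add_smul, hab, one_smul]
  refine convexHull_min (fun τ (hτ : IsPureProduct τ) => And.intro ?_ hτ.trace_eq_one) hconv h
  obtain ⟨ψ, φ, -, -, rfl⟩ := hτ
  exact ((posSemidef_vecMulVec_self_star ψ).kronecker (posSemidef_vecMulVec_self_star φ)).1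

theorem IsOneLOCC.isHermitian {M : Matrix (Fin dA × Fin dB) (Fin dA × Fin dB) ℂ}
    (h : IsOneLOCC M) : M.IsHermitian := by
  obtain ⟨m, A, E, hA, hE, -, rfl⟩ := h
  exact (posSemidef_sum _ fun x _ => (hA x).1.kronecker (hE x)).1

theorem norm_trace_mul_eq_abs_re {n : Type*} [Fintype n] {M X : Matrix n n ℂ}
    (hM : M.IsHermitian) (hX : X.IsHermitian) : ‖(M * X).trace‖ = |(M * X).trace.re| := by
  have h : star (M * X).trace = (M * X).trace := by
    rw [← trace_conjTranspose, conjTranspose_mul, hM.eq, hX.eq, trace_mul_comm]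
  obtain ⟨r, hr⟩ := Complex.conj_eq_iff_real.1 h
  rw [hr, Complex.norm_real, Complex.ofReal_re, Real.norm_eq_abs]

/-- The de Finetti bound with a separable state that is independent of the measurement. -/
theorem exists_isSeparable_forall_norm_trace_le {k : ℕ} (hk : 1 ≤ k)
    {ρ : Matrix (Fin dA × Fin dB) (Fin dA × Fin dB) ℂ} (hρ : IsState ρ)
    (hext : IsExtendible k ρ) :
    ∃ σ, IsSeparable σ ∧ ∀ M, IsOneLOCC M →
      ‖(M * (ρ - σ)).trace‖ ≤ √(Real.log dA / (2 * k)) := by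
  obtain ⟨σ, hσ, h⟩ := exists_isSeparable_forall_trace_le
    fun M hM => exists_isSeparable_trace_le hk hext hM
  obtain ⟨hσh, hσ1⟩ := hσ.isHermitian_and_trace
  refine ⟨σ, hσ, fun M hM => ?_⟩
  rw [norm_trace_mul_eq_abs_re hM.isHermitian (hρ.1.1.sub hσh), abs_le']
  refine ⟨h M hM, ?_⟩
  -- Since `tr (ρ - σ) = 0`, the complementary measurement has the opposite error.
  have := h (1 - M) hM.one_sub
  rwa [Matrix.sub_mul, Matrix.one_mul, trace_sub, trace_sub, hρ.2, hσ1, sub_self, zero_sub,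
    Complex.neg_re] at this

end QInfo

theorem mainTheorem2 :
    ∃ C : ℝ, 0 < C ∧
      ∀ (dA dB k : ℕ) (ρ : Matrix (Fin dA × Fin dB) (Fin dA × Fin dB) ℂ),
        1 ≤ k → QInfo.IsState ρ → QInfo.IsExtendible k ρ →
        (∀ M : Matrix (Fin dA × Fin dB) (Fin dA × Fin dB) ℂ, QInfo.IsOneLOCC M →
          ∃ σ : Matrix (Fin dA × Fin dB) (Fin dA × Fin dB) ℂ, QInfo.IsSeparable σ ∧
            ‖(M * (ρ - σ)).trace‖ ≤ C * Real.sqrt (Real.logb 2 dA / k)) ∧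
        (∃ σ : Matrix (Fin dA × Fin dB) (Fin dA × Fin dB) ℂ, QInfo.IsSeparable σ ∧
          (∀ M : Matrix (Fin dA × Fin dB) (Fin dA × Fin dB) ℂ, QInfo.IsOneLOCC M →
            ‖(M * (ρ - σ)).trace‖ ≤ C * Real.sqrt (Real.logb 2 dA / k)) ∧
          QInfo.oneLOCCNorm (ρ - σ)
            ≤ Real.sqrt (2 * Real.log 2 * Real.logb 2 dA / k)) := by
  have hlog2 : 0 < Real.log 2 := Real.log_pos one_lt_two
  -- `C = 1` is not optimal: changing the base of the logarithm only requires `log 2 ≤ 2`.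
  refine ⟨1, one_pos, fun dA dB k ρ hk hρ hext => ?_⟩
  obtain ⟨σ, hσ, h⟩ := QInfo.exists_isSeparable_forall_norm_trace_le hk hρ hext
  have hbound : ∀ M, QInfo.IsOneLOCC M →
      ‖(M * (ρ - σ)).trace‖ ≤ 1 * Real.sqrt (Real.logb 2 dA / k) := by
    intro M hM
    rw [one_mul]
    refine (h M hM).trans (Real.sqrt_le_sqrt ?_)
    rw [Real.logb, ← div_div]
    gcongr
    linarith [Real.log_two_lt_d9]
  refine ⟨fun M hM => ⟨σ, hσ, hbound M hM⟩, σ, hσ, hbound, ?_⟩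
  have hsup : sSup {r : ℝ | ∃ M, QInfo.IsOneLOCC M ∧ r = ‖(M * (ρ - σ)).trace‖}
      ≤ Real.sqrt (Real.log dA / (2 * k)) := by
    refine Real.sSup_le ?_ (Real.sqrt_nonneg _)
    rintro r ⟨M, hM, rfl⟩
    exact h M hM
  rw [QInfo.oneLOCCNorm]
  -- Nothing is lost here: `2 √(log dA / (2k))` equals the stated norm bound.
  refine (mul_le_mul_of_nonneg_left hsup zero_le_two).trans (le_of_eq ?_)
  rw [← Real.sqrt_sq (zero_le_two : (0 : ℝ) ≤ 2), ← Real.sqrt_mul (by positivity), Real.logb]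
  congr 1
  field_simp
  ring
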